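/- A configuration $\eta\in\{0,1,2,\dots\}^{\mathbb Z}$ assigns a height to each site of $\mathbb Z$; a site $x$ is called active (unstable) if $\eta(x)\ge 2$. In one parallel time step of the classical sandpile on $\mathbb Z$, all active sites topple simultaneously, each exactly once, where a toppling of $x$ decreases the height of $x$ by $2$ and increases the heights of $x-1$ and of $x+1$ by $1$ each. For $\rho\ge 0$ let the initial heights be independent Poisson($\rho$) random variables, with joint law $\mu_\rho$, and let $\eta^t$ be the configuration after $t$ parallel time steps. Then for every $\rho\ge 0$ and every integer $t\ge 0$ there is a (unique) constant $\alpha_\rho(t)$ such that, $\mu_\rho$-almost surely, $$\alpha_\rho(t)=\lim_{n\to\infty}\frac{\#\{x\in[-n,n]\cap\mathbb Z:\ \eta^t(x)\ge 2\}}{2n+1},$$ and the following hold. 1. For $\rho<1$, $\lim_{t\to\infty}\alpha_\rho(t)=0$. 2. For $\rho>2$, $\lim_{t\to\infty}\alpha_\rho(t)=1$. 3. For $1<\rho<2$, $\lim_{T\to\infty}\frac1T\sum_{t=1}^T\alpha_\rho(t)=\frac12$. -/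

import Mathlib

open MeasureTheory ProbabilityTheory Filter
open scoped NNReal Topology

namespace Sandpile

/-- A site is active (unstable) in the height configuration `η` if its height is at least 2. -/
def Active (η : ℤ → ℕ) (x : ℤ) : Prop := 2 ≤ η x

instance (η : ℤ → ℕ) : DecidablePred (Active η) := fun x => Nat.decLe 2 (η x)

/-- One parallel time step of the classical sandpile on `ℤ`: every active site topples exactly
once, losing two particles and sending one of them to each of its two neighbours. -/
def step (η : ℤ → ℕ) (x : ℤ) : ℕ :=
  (if Active η x then η x - 2 else η x)
    + (if Active η (x - 1) then 1 else 0)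
    + (if Active η (x + 1) then 1 else 0)

/-- The configuration after `t` parallel time steps started from `η`. -/
def evolve (t : ℕ) (η : ℤ → ℕ) : ℤ → ℕ := step^[t] η

/-- The fraction of active sites among the `2n + 1` sites of `[-n, n]`. -/
noncomputable def activeFraction (n : ℕ) (η : ℤ → ℕ) : ℝ :=
  (((Finset.Icc (-(n : ℤ)) n).filter (Active η)).card : ℝ) / (2 * n + 1)

/-- The law of the initial configuration: independent Poisson(`ρ`) heights at the sites of `ℤ`. -/
noncomputable def initialLaw (ρ : ℝ≥0) : Measure (ℤ → ℕ) :=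
  Measure.infinitePi (fun _ : ℤ => poissonMeasure ρ)

/-- `a` is the density of active sites at time `t`: for almost every initial configuration, the
fraction of active sites in `[-n, n]` at time `t` converges to the constant `a` as `n → ∞`.
As `initialLaw ρ` is a probability measure, there is at most one such `a`. -/
def IsActivityDensity (ρ : ℝ≥0) (t : ℕ) (a : ℝ) : Prop :=
  ∀ᵐ η ∂(initialLaw ρ), Tendsto (fun n : ℕ => activeFraction n (evolve t η)) atTop (𝓝 a)

end Sandpile

/-!
If the heights of `η` average to `m < 1` on both half-lines, then the discrete Poisson equation
`Δv = 1 - η` has a solution `v ≥ 0`: the increments of a solution are partial sums of `1 - η`, which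
are eventually positive to the right and eventually negative to the left, so every solution is
bounded below. Toppling each site `x` exactly `v x` times would stabilize `η`, so by the least
action principle `x` topples at most `v x` times. Replacing `η` by `3 - η` exchanges topplings and
idle steps; hence for `m > 2` every site is idle only finitely often. For `m > 1`, solve instead
`Δv = η - ξ`, where `ξ` has height `2` at odd and `0` at even sites: under `ξ` every site topples at
every other step, and `x` lags behind by at most `v x` topplings under `η`. With the dual bound,
for `1 < m < 2` the site `x` topples `T / 2 + O(1)` times in `T` steps.

Whether a site is active at time `t` depends only on the initial heights within distance `t`. Along
each residue class modulo `2 t + 1` these events are therefore independent, and the strong law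
yields the density of active sites, namely the probability that the origin is active at time `t`.
Dominated convergence transfers the almost sure limits at the origin to these probabilities.
-/

namespace Sandpile

/-! ### Discrete primitives -/

section Primitive

variable {G : Type*} [AddCommGroup G]

/-- The discrete primitive of `f` that vanishes at `0`, the analogue of `∫ k in 0..x, f k`; for each
`x` at most one of the two sums is nonempty. -/
noncomputable def primitive (f : ℤ → G) (x : ℤ) : G :=
  ∑ k ∈ Finset.Ico 0 x, f k - ∑ k ∈ Finset.Ico x 0, f k

@[simp]
theorem primitive_zero (f : ℤ → G) : primitive f 0 = 0 := by simp [primitive]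

theorem primitive_add_one (f : ℤ → G) (x : ℤ) : primitive f (x + 1) = primitive f x + f x := by
  rcases lt_or_ge x 0 with hx | hx
  · rw [primitive, primitive, Finset.Ico_eq_empty_of_le hx.le,
      Finset.Ico_eq_empty_of_le (Int.add_one_le_of_lt hx),
      ← Finset.insert_Ico_add_one_left_eq_Ico hx, Finset.sum_insert (by simp)]
    simp
  · rw [primitive, primitive, Finset.Ico_eq_empty_of_le hx,
      Finset.Ico_eq_empty_of_le (a := x + 1) (by lia),
      ← Finset.sum_Ico_add_eq_sum_Ico_add_one hx]
    simp

theorem eq_primitive {f u : ℤ → G} (h0 : u 0 = 0) (h : ∀ x, u (x + 1) = u x + f x) (x : ℤ) :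
    u x = primitive f x := by
  induction x with
  | zero => rw [h0, primitive_zero]
  | succ n ih => rw [h, ih, primitive_add_one]
  | pred n ih =>
    have hu := h (-n - 1)
    have hp := primitive_add_one f (-n - 1)
    rw [sub_add_cancel] at hu hp
    rw [hu, hp] at ih
    exact add_right_cancel ih

theorem primitive_sub (f g : ℤ → G) (x : ℤ) :
    primitive (fun x => f x - g x) x = primitive f x - primitive g x := by
  simp only [primitive, Finset.sum_sub_distrib]
  abel

theorem primitive_natCast (f : ℤ → G) (n : ℕ) :
    primitive f n = ∑ k ∈ Finset.range n, f k := by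
  induction n with
  | zero => simp
  | succ n ih => rw [Nat.cast_succ, primitive_add_one, ih, Finset.sum_range_succ]

theorem primitive_neg_natCast (f : ℤ → G) (n : ℕ) :
    primitive f (-n) = -∑ k ∈ Finset.range n, f (-1 - k) := by
  induction n with
  | zero => simp
  | succ n ih =>
    have h := primitive_add_one f (-1 - n)
    rw [show (-1 - n + 1 : ℤ) = -n by ring, ih] at h
    rw [Nat.cast_succ, show (-(n + 1) : ℤ) = -1 - n by ring, Finset.sum_range_succ, neg_add, h]
    abel

theorem primitive_sub_primitive (f : ℤ → G) {a b : ℤ} (hab : a ≤ b) :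
    primitive f b - primitive f a = ∑ x ∈ Finset.Ico a b, f x := by
  induction b, hab using Int.leInduction with
  | base => simp
  | succ b hab ih =>
    rw [primitive_add_one, ← Finset.sum_Ico_add_eq_sum_Ico_add_one hab, ← ih]
    abel

end Primitive

theorem intCast_primitive (f : ℤ → ℤ) (x : ℤ) :
    ((primitive f x : ℤ) : ℝ) = primitive (fun x => (f x : ℝ)) x := by
  simp [primitive]

/-- The discrete Laplacian on `ℤ`: the net change of the height of `x` if every site `y` topples
`v y` times. -/
def laplacian {R : Type*} [Ring R] (v : ℤ → R) (x : ℤ) : R := v (x - 1) + v (x + 1) - 2 * v x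

theorem laplacian_primitive_primitive {R : Type*} [Ring R] (f : ℤ → R) (x : ℤ) :
    laplacian (primitive fun y => primitive f (y + 1)) x = f x := by
  have h := primitive_add_one (fun y => primitive f (y + 1)) (x - 1)
  simp only [sub_add_cancel] at h
  rw [laplacian, primitive_add_one, primitive_add_one, h, two_mul]
  abel

theorem bddBelow_range_of_eventually_le_add_one {α : Type*} [Preorder α]
    [IsCodirectedOrder α] {v : ℤ → α}
    (hr : ∀ᶠ x in atTop, v x ≤ v (x + 1)) (hl : ∀ᶠ x in atBot, v (x + 1) ≤ v x) :
    BddBelow (Set.range v) := by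
  obtain ⟨b, hb⟩ := eventually_atTop.1 hr
  obtain ⟨a, ha⟩ := eventually_atBot.1 hl
  have hright : IsBoundedUnder (· ≥ ·) atTop v := by
    refine isBoundedUnder_of_eventually_ge (a := v b) ?_
    filter_upwards [eventually_ge_atTop b] with x hx
    induction x, hx using Int.leInduction with
    | base => exact le_rfl
    | succ x hx ih => exact ih.trans (hb x hx)
  have hleft : IsBoundedUnder (· ≥ ·) atBot v := by
    refine isBoundedUnder_of_eventually_ge (a := v a) ?_
    filter_upwards [eventually_le_atBot a] with x hx
    induction x, hx using Int.leInductionDown with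
    | base => exact le_rfl
    | pred x hx ih => exact ih.trans (by simpa using ha (x - 1) (by lia))
  refine IsBoundedUnder.bddBelow_range_of_cofinite ?_
  rw [IsBoundedUnder, Int.cofinite_eq, map_sup]
  exact isBounded_sup hleft hright

/-! ### Mean values -/

/-- The averages of `f` over `[0, n)` and over `[-n, 0)` both tend to `m` as `n → ∞`. These averages
are the quotients `primitive f x / x` at `x = n` and at `x = -n`, so that one limit along `cofinite`
covers both half-lines. -/
def HasMean (f : ℤ → ℝ) (m : ℝ) : Prop :=
  Tendsto (fun x : ℤ => primitive f x / x) cofinite (𝓝 m)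

namespace HasMean

theorem of_tendsto_range {f : ℤ → ℝ} {m : ℝ}
    (hr : Tendsto (fun n : ℕ => (∑ k ∈ Finset.range n, f k) / n) atTop (𝓝 m))
    (hl : Tendsto (fun n : ℕ => (∑ k ∈ Finset.range n, f (-1 - k)) / n) atTop (𝓝 m)) :
    HasMean f m := by
  rw [HasMean, Int.cofinite_eq, tendsto_sup, ← map_neg_atTop, ← Nat.map_cast_int_atTop,
    tendsto_map'_iff, tendsto_map'_iff, tendsto_map'_iff]
  refine ⟨hl.congr fun n => ?_, hr.congr fun n => ?_⟩
  · simp [primitive_neg_natCast, neg_div_neg_eq]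
  · simp [primitive_natCast]

theorem sub {f g : ℤ → ℝ} {a b : ℝ} (hf : HasMean f a) (hg : HasMean g b) :
    HasMean (fun x => f x - g x) (a - b) := by
  simpa only [HasMean, primitive_sub, sub_div] using Tendsto.sub hf hg

theorem const (c : ℝ) : HasMean (fun _ => c) c := by
  refine tendsto_const_nhds.congr' ?_
  filter_upwards [eventually_cofinite_ne 0] with x hx
  rw [← eq_primitive (u := fun x : ℤ => c * x) (by simp) fun x => by push_cast; ring]
  field_simp

theorem const_sub {f : ℤ → ℝ} {m : ℝ} (hf : HasMean f m) (c : ℝ) :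
    HasMean (fun x => c - f x) (c - m) :=
  (const c).sub hf

theorem tendsto_primitive_atTop {f : ℤ → ℝ} {m : ℝ} (hf : HasMean f m) (hm : 0 < m) :
    Tendsto (primitive f) atTop atTop := by
  refine ((hf.mono_left (Int.cofinite_eq ▸ le_sup_right)).pos_mul_atTop hm
    tendsto_intCast_atTop_atTop).congr' ?_
  filter_upwards [eventually_ne_atTop 0] with x hx
  field_simp

theorem tendsto_primitive_atBot {f : ℤ → ℝ} {m : ℝ} (hf : HasMean f m) (hm : 0 < m) :
    Tendsto (primitive f) atBot atBot := by
  refine ((hf.mono_left (Int.cofinite_eq ▸ le_sup_left)).pos_mul_atBot hm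
    (tendsto_intCast_atBot_iff (f := fun x : ℤ => x).2 tendsto_id)).congr' ?_
  filter_upwards [eventually_ne_atBot 0] with x hx
  field_simp

theorem tendsto_average_Icc {f : ℤ → ℝ} {m : ℝ} (hf : HasMean f m) :
    Tendsto (fun n : ℕ => (∑ x ∈ Finset.Icc (-(n : ℤ)) n, f x) / (2 * n + 1)) atTop (𝓝 m) := by
  set a : ℤ → ℝ := fun x => primitive f x / x
  have hr : Tendsto (fun n : ℕ => a (n + 1)) atTop (𝓝 m) :=
    (hf.mono_left (Int.cofinite_eq ▸ le_sup_right)).comp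
      (tendsto_atTop_add_const_right _ 1 tendsto_natCast_atTop_atTop)
  have hl : Tendsto (fun n : ℕ => a (-n)) atTop (𝓝 m) :=
    (hf.mono_left (Int.cofinite_eq ▸ le_sup_left)).comp
      (tendsto_neg_atTop_atBot.comp tendsto_natCast_atTop_atTop)
  have hmix : Tendsto (fun n : ℕ => (n + 1) / (2 * n + 1) * (a (n + 1) - a (-n)) + a (-n))
      atTop (𝓝 m) := by
    have hdiff : Tendsto (fun n : ℕ => a (n + 1) - a (-n)) atTop (𝓝 0) := by
      simpa using hr.sub hl
    have hweight (n : ℕ) : 0 ≤ ((n : ℝ) + 1) / (2 * n + 1) ∧ ((n : ℝ) + 1) / (2 * n + 1) ≤ 1 :=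
      ⟨by positivity, div_le_one_of_le₀ (by linarith [n.cast_nonneg (α := ℝ)]) (by positivity)⟩
    simpa using (bdd_le_mul_tendsto_zero' 1 (.of_forall fun n => abs_le.2
      ⟨by linarith [hweight n], (hweight n).2⟩) hdiff).add hl
  refine hmix.congr' ?_
  filter_upwards [eventually_ne_atTop 0] with n hn
  rw [← Finset.Ico_add_one_right_eq_Icc, ← primitive_sub_primitive f (by lia)]
  simp only [a]
  push_cast
  field_simp
  ring

theorem two_mul_emod_two : HasMean (fun x => ((2 * (x % 2) : ℤ) : ℝ)) 1 := by
  have hbdd : ∀ᶠ x : ℤ in cofinite, |((x % 2 : ℤ) : ℝ)| ≤ 2 := .of_forall fun x => by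
    rw [← Int.cast_abs]
    exact_mod_cast abs_le.2 ⟨by lia, by lia⟩
  have hinv : Tendsto (fun x : ℤ => (x : ℝ)⁻¹) cofinite (𝓝 0) :=
    tendsto_inv₀_cobounded.comp (Int.cofinite_eq ▸ tendsto_intCast_atBot_sup_atTop_cobounded)
  have hlim : Tendsto (fun x : ℤ => 1 - ((x % 2 : ℤ) : ℝ) * (x : ℝ)⁻¹) cofinite (𝓝 1) := by
    simpa using (bdd_le_mul_tendsto_zero' 2 hbdd hinv).const_sub 1
  refine hlim.congr' ?_
  filter_upwards [eventually_cofinite_ne 0] with x hx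
  rw [← intCast_primitive, ← eq_primitive (u := fun x => x - x % 2) (by simp) fun x => by lia]
  push_cast
  field_simp

theorem exists_nonneg_laplacian_eq {f : ℤ → ℤ} {m : ℝ} (hf : HasMean (fun x => (f x : ℝ)) m)
    (hm : 0 < m) : ∃ v : ℤ → ℤ, (∀ x, 0 ≤ v x) ∧ ∀ x, laplacian v x = f x := by
  set u := primitive fun y => primitive f (y + 1) with hu
  have hr : ∀ᶠ x in atTop, 0 ≤ primitive f x := by
    filter_upwards [(hf.tendsto_primitive_atTop hm).eventually_ge_atTop 0] with x hx
    rw [← intCast_primitive] at hx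
    exact_mod_cast hx
  have hl : ∀ᶠ x in atBot, primitive f x ≤ 0 := by
    filter_upwards [(hf.tendsto_primitive_atBot hm).eventually_le_atBot 0] with x hx
    rw [← intCast_primitive] at hx
    exact_mod_cast hx
  obtain ⟨b, hb⟩ : BddBelow (Set.range u) := bddBelow_range_of_eventually_le_add_one
    (((tendsto_atTop_add_const_right _ 1 tendsto_id).eventually hr).mono fun x hx => by
      rw [hu, primitive_add_one]; exact le_add_of_nonneg_right hx)
    (((tendsto_atBot_add_const_right _ 1 tendsto_id).eventually hl).mono fun x hx => by
      rw [hu, primitive_add_one]; exact add_le_of_nonpos_right hx)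
  refine ⟨fun x => u x - b, fun x => sub_nonneg.2 (hb ⟨x, rfl⟩), fun x => ?_⟩
  rw [← laplacian_primitive_primitive f x, laplacian, laplacian]
  ring

end HasMean

/-! ### The odometer -/

/-- The number of topplings of the site `x` before time `t` in the parallel sandpile started from
the integer-valued configuration `ζ`. Negative heights are allowed so that `ζ` may be replaced by
`3 - ζ`. -/
def odometer (ζ : ℤ → ℤ) : ℕ → ℤ → ℤ
  | 0, _ => 0
  | t + 1, x => odometer ζ t x + if 2 ≤ ζ x + laplacian (odometer ζ t) x then 1 else 0

/-- Least action principle. -/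
theorem odometer_le_of_stabilizing {ζ v : ℤ → ℤ} (hv : ∀ x, 0 ≤ v x)
    (hζ : ∀ x, ζ x + laplacian v x ≤ 1) (t : ℕ) (x : ℤ) : odometer ζ t x ≤ v x := by
  induction t generalizing x with
  | zero => exact hv x
  | succ t ih =>
    have h0 := ih x
    have hl := ih (x - 1)
    have hr := ih (x + 1)
    have hx := hζ x
    rw [odometer]
    unfold laplacian at *
    split_ifs <;> lia

/-- From height `2` at odd sites and `0` at even sites, odd and even sites topple in turn, so `x`
has toppled `(t + x % 2) / 2` times before time `t`. -/
theorem alternating_sub_le_odometer {ζ v : ℤ → ℤ} (hv : ∀ x, 0 ≤ v x)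
    (hζ : ∀ x, laplacian v x = ζ x - 2 * (x % 2)) (t : ℕ) (x : ℤ) :
    (t + x % 2) / 2 - v x ≤ odometer ζ t x := by
  induction t generalizing x with
  | zero =>
    have := hv x
    rw [odometer]
    lia
  | succ t ih =>
    have h0 := ih x
    have hl := ih (x - 1)
    have hr := ih (x + 1)
    have hx := hζ x
    rw [odometer]
    unfold laplacian at *
    split_ifs <;> lia

theorem odometer_three_sub (ζ : ℤ → ℤ) (t : ℕ) (x : ℤ) :
    odometer (fun x => 3 - ζ x) t x = t - odometer ζ t x := by
  induction t generalizing x with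
  | zero => simp [odometer]
  | succ t ih =>
    simp only [odometer, laplacian, ih]
    split_ifs <;> lia

namespace HasMean

variable {ζ : ℤ → ℤ} {m : ℝ}

theorem exists_odometer_le (hζ : HasMean (fun x => (ζ x : ℝ)) m) (hm : m < 1) :
    ∃ v : ℤ → ℤ, ∀ t x, odometer ζ t x ≤ v x := by
  have hmean : HasMean (fun x => ((1 - ζ x : ℤ) : ℝ)) (1 - m) := by
    simpa using hζ.const_sub 1
  obtain ⟨v, hv, hΔ⟩ := hmean.exists_nonneg_laplacian_eq (by linarith)
  exact ⟨v, odometer_le_of_stabilizing hv fun x => by rw [hΔ]; lia⟩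

theorem exists_half_sub_le_odometer (hζ : HasMean (fun x => (ζ x : ℝ)) m) (hm : 1 < m) :
    ∃ v : ℤ → ℤ, ∀ (t : ℕ) x, (t : ℤ) / 2 - v x ≤ odometer ζ t x := by
  have hmean : HasMean (fun x => ((ζ x - 2 * (x % 2) : ℤ) : ℝ)) (m - 1) := by
    simpa using hζ.sub two_mul_emod_two
  obtain ⟨v, hv, hΔ⟩ := hmean.exists_nonneg_laplacian_eq (by linarith)
  refine ⟨v, fun t x => ?_⟩
  have := alternating_sub_le_odometer hv hΔ t x
  lia

end HasMean

/-! ### Activity of the sandpile -/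

theorem evolve_succ (t : ℕ) (η : ℤ → ℕ) : evolve (t + 1) η = step (evolve t η) :=
  Function.iterate_succ_apply' step t η

theorem natCast_step (η : ℤ → ℕ) (x : ℤ) :
    (step η x : ℤ) = η x + laplacian (fun y => if Active η y then 1 else 0) x := by
  unfold step laplacian Active
  split_ifs <;> lia

theorem natCast_evolve (η : ℤ → ℕ) (t : ℕ) (x : ℤ) :
    (evolve t η x : ℤ) = η x + laplacian (odometer (fun y => η y) t) x := by
  induction t generalizing x with
  | zero => simp [evolve, odometer, laplacian]
  | succ t ih =>
    rw [evolve_succ, natCast_step, ih]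
    simp only [laplacian, odometer, Active] at ih ⊢
    simp only [← ih, Nat.ofNat_le_cast]
    linear_combination ih x

theorem measurable_step : Measurable step := by
  refine measurable_pi_lambda _ fun x => ?_
  let g : ℕ × ℕ × ℕ → ℕ := fun p =>
    (if 2 ≤ p.1 then p.1 - 2 else p.1) + (if 2 ≤ p.2.1 then 1 else 0)
      + (if 2 ≤ p.2.2 then 1 else 0)
  exact (measurable_of_countable g).comp (f := fun η : ℤ → ℕ => (η x, η (x - 1), η (x + 1)))
    (by fun_prop)

theorem measurable_evolve (t : ℕ) : Measurable (evolve t) := measurable_step.iterate t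

theorem dependsOn_evolve (t : ℕ) (x : ℤ) :
    DependsOn (fun η => evolve t η x) (Set.Icc (x - t) (x + t)) := by
  induction t generalizing x with
  | zero => exact fun η η' h => h x (by simp)
  | succ t ih =>
    intro η η' h
    have hnear (y : ℤ) (hy : x - 1 ≤ y ∧ y ≤ x + 1) : evolve t η y = evolve t η' y :=
      ih y fun z hz => h z (by simp only [Set.mem_Icc] at hz ⊢; lia)
    simp only [evolve_succ, step, Active, hnear x (by lia), hnear (x - 1) (by lia),
      hnear (x + 1) (by lia)]

/-- The indicator of the active sites of `η`. -/
def activity (η : ℤ → ℕ) (x : ℤ) : ℝ := if Active η x then 1 else 0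

theorem activity_nonneg (η : ℤ → ℕ) (x : ℤ) : 0 ≤ activity η x := by
  unfold activity; split_ifs <;> norm_num

theorem activity_le_one (η : ℤ → ℕ) (x : ℤ) : activity η x ≤ 1 := by
  unfold activity; split_ifs <;> norm_num

theorem norm_activity_le_one (η : ℤ → ℕ) (x : ℤ) : ‖activity η x‖ ≤ 1 := by
  rw [Real.norm_of_nonneg (activity_nonneg η x)]
  exact activity_le_one η x

theorem measurable_activity_evolve (t : ℕ) (x : ℤ) :
    Measurable fun η => activity (evolve t η) x := by
  have : Measurable fun n : ℕ => if 2 ≤ n then (1 : ℝ) else 0 := measurable_from_nat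
  exact this.comp ((measurable_pi_apply x).comp (measurable_evolve t))

theorem dependsOn_activity_evolve (t : ℕ) (x : ℤ) :
    DependsOn (fun η => activity (evolve t η) x) (Set.Icc (x - t) (x + t)) := fun η η' h => by
  simp only [activity, Active, dependsOn_evolve t x h]

theorem activeFraction_eq_sum_activity (n : ℕ) (η : ℤ → ℕ) :
    activeFraction n η = (∑ x ∈ Finset.Icc (-(n : ℤ)) n, activity η x) / (2 * n + 1) := by
  simp only [activeFraction, activity, Finset.sum_boole]

theorem sum_range_activity_evolve (η : ℤ → ℕ) (t : ℕ) (x : ℤ) :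
    ∑ s ∈ Finset.range t, activity (evolve s η) x = odometer (fun y => η y) t x := by
  induction t with
  | zero => simp [odometer]
  | succ t ih =>
    rw [Finset.sum_range_succ, ih, odometer, ← natCast_evolve]
    simp only [activity, Active, Nat.ofNat_le_cast]
    push_cast
    rfl

theorem tendsto_one_div_mul_of_abs_sub_mul_le {u : ℕ → ℝ} {c C : ℝ}
    (h : ∀ n : ℕ, |u n - n * c| ≤ C) :
    Tendsto (fun n : ℕ => 1 / (n : ℝ) * u n) atTop (𝓝 c) := by
  have hlim : Tendsto (fun n : ℕ => (u n - n * c) * (1 / (n : ℝ)) + c) atTop (𝓝 c) := by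
    simpa using (bdd_le_mul_tendsto_zero' C (.of_forall h)
      tendsto_one_div_atTop_nhds_zero_nat).add_const c
  refine hlim.congr' ?_
  filter_upwards [eventually_ne_atTop 0] with n hn
  field_simp
  ring

section LongTime

variable {η : ℤ → ℕ} {m : ℝ}

theorem tendsto_activity_evolve_zero (hη : HasMean (fun x => (η x : ℝ)) m) (hm : m < 1) (x : ℤ) :
    Tendsto (fun t => activity (evolve t η) x) atTop (𝓝 0) := by
  obtain ⟨v, hv⟩ := HasMean.exists_odometer_le (ζ := fun x => η x) (by simpa using hη) hm
  refine (summable_of_sum_range_le (c := v x) (fun t => activity_nonneg _ x)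
    fun t => ?_).tendsto_atTop_zero
  rw [sum_range_activity_evolve]
  exact_mod_cast hv t x

theorem tendsto_activity_evolve_one (hη : HasMean (fun x => (η x : ℝ)) m) (hm : 2 < m) (x : ℤ) :
    Tendsto (fun t => activity (evolve t η) x) atTop (𝓝 1) := by
  obtain ⟨v, hv⟩ := HasMean.exists_odometer_le (ζ := fun x => 3 - η x)
    (by simpa using hη.const_sub 3) (by linarith)
  have hidle : Tendsto (fun t => 1 - activity (evolve t η) x) atTop (𝓝 0) := by
    refine (summable_of_sum_range_le (c := v x) (fun t => sub_nonneg.2 (activity_le_one _ x))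
      fun t => ?_).tendsto_atTop_zero
    rw [Finset.sum_sub_distrib, sum_range_activity_evolve]
    have := hv t x
    rw [odometer_three_sub] at this
    simpa using (by exact_mod_cast this : ((t - odometer (fun y => η y) t x : ℤ) : ℝ) ≤ v x)
  simpa using hidle.const_sub 1

theorem tendsto_average_activity_evolve (hη : HasMean (fun x => (η x : ℝ)) m) (h1 : 1 < m)
    (h2 : m < 2) (x : ℤ) :
    Tendsto (fun T : ℕ => 1 / (T : ℝ) * ∑ t ∈ Finset.Icc 1 T, activity (evolve t η) x) atTop
      (𝓝 (1 / 2)) := by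
  obtain ⟨v, hv⟩ := HasMean.exists_half_sub_le_odometer (ζ := fun x => η x) (by simpa using hη) h1
  obtain ⟨w, hw⟩ := HasMean.exists_half_sub_le_odometer (ζ := fun x => 3 - η x)
    (by simpa using hη.const_sub 3) (by linarith)
  set u : ℕ → ℤ := fun t => odometer (fun y => η y) t x
  refine tendsto_one_div_mul_of_abs_sub_mul_le (C := v x + w x + 2) fun T => ?_
  have hsum : ∑ t ∈ Finset.Icc 1 T, activity (evolve t η) x = (u (T + 1) - u 1 : ℤ) := by
    rw [← Finset.Ico_add_one_right_eq_Icc, Finset.sum_Ico_eq_sub _ (by lia),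
      sum_range_activity_evolve, sum_range_activity_evolve, Int.cast_sub]
  have hlo (t : ℕ) : (t : ℤ) / 2 - v x ≤ u t := hv t x
  have hhi (t : ℕ) : (t : ℤ) / 2 - w x ≤ t - u t := odometer_three_sub _ t x ▸ hw t x
  have hbound : |2 * (u (T + 1) - u 1) - T| ≤ 2 * (v x + w x + 2) := by
    have := hlo 1
    have := hhi 1
    have := hlo (T + 1)
    have := hhi (T + 1)
    rw [abs_le]
    constructor <;> lia
  have hbound' : |2 * ((u (T + 1) : ℝ) - u 1) - T| ≤ 2 * (v x + w x + 2) := by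
    exact_mod_cast hbound
  rw [abs_le] at hbound' ⊢
  push_cast [hsum]
  constructor <;> linarith [hbound'.1, hbound'.2]

end LongTime
/-! ### Strong laws for local observables -/

theorem sum_range_mul_eq_sum_residues {M : Type*} [AddCommMonoid M] (a : ℕ → M) (m n : ℕ) :
    ∑ k ∈ Finset.range (m * n), a k =
      ∑ r ∈ Finset.range m, ∑ k ∈ Finset.range n, a (r + m * k) := by
  induction n with
  | zero => simp
  | succ n ih =>
    rw [Nat.mul_succ, Finset.sum_range_add, ih]
    simp only [Finset.sum_range_succ, Finset.sum_add_distrib, add_comm]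

theorem tendsto_average_of_residues {a : ℕ → ℝ} (ha : ∀ k, 0 ≤ a k) {m : ℕ} (hm : 0 < m) {p : ℝ}
    (h : ∀ r < m, Tendsto (fun n : ℕ => (∑ k ∈ Finset.range n, a (r + m * k)) / n) atTop (𝓝 p)) :
    Tendsto (fun n : ℕ => (∑ k ∈ Finset.range n, a k) / n) atTop (𝓝 p) := by
  have hm' : (0 : ℝ) < m := by positivity
  refine tendsto_div_of_monotone_of_exists_subseq_tendsto_div _ _
    (fun i j hij => Finset.sum_le_sum_of_subset_of_nonneg (by simpa using hij)
      fun _ _ _ => ha _) fun b hb => ⟨fun n => m * n, ?_, ?_, ?_⟩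
  · filter_upwards [tendsto_natCast_atTop_atTop.eventually_ge_atTop (1 / (b - 1))] with n hn
    have : 1 ≤ n * (b - 1) := (div_le_iff₀ (by linarith)).1 hn
    push_cast
    nlinarith
  · exact tendsto_id.const_mul_atTop' hm
  · have hsum := (tendsto_finsetSum (Finset.range m) fun r hr =>
      h r (Finset.mem_range.1 hr)).div_const (m : ℝ)
    rw [Finset.sum_const, Finset.card_range, nsmul_eq_mul, mul_div_cancel_left₀ _ hm'.ne'] at hsum
    refine hsum.congr fun n => ?_
    rw [sum_range_mul_eq_sum_residues, ← Finset.sum_div, div_div, Nat.cast_mul, mul_comm (n : ℝ)]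

theorem indepFun_infinitePi_of_dependsOn {ι : Type*} {X : ι → Type*} [∀ i, MeasurableSpace (X i)]
    {P : ∀ i, Measure (X i)} [∀ i, IsProbabilityMeasure (P i)] {β γ : Type*} [MeasurableSpace β]
    [MeasurableSpace γ] {F : (∀ i, X i) → β} {G : (∀ i, X i) → γ} {S T : Finset ι}
    (hF : Measurable F) (hG : Measurable G) (hFS : DependsOn F S) (hGT : DependsOn G T)
    (hST : Disjoint S T) : IndepFun F G (Measure.infinitePi P) := by
  classical
  have hX (i : ι) : Nonempty (X i) := nonempty_of_isProbabilityMeasure (P i)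
  let base : ∀ i, X i := fun i => (hX i).some
  have hcoord : iIndepFun (fun (i : ι) (η : ∀ i, X i) => η i) (Measure.infinitePi P) :=
    iIndepFun_infinitePi (X := fun _ a => a) fun _ => measurable_id
  have hrestrict := hcoord.indepFun_finset S T hST fun i => measurable_pi_apply i
  convert hrestrict.comp (hF.comp (measurable_updateFinset (x := base)))
    (hG.comp (measurable_updateFinset (x := base))) using 1
  · funext η
    exact hFS fun i hi => by simp [Function.updateFinset, Finset.mem_coe.1 hi]
  · funext η
    exact hGT fun i hi => by simp [Function.updateFinset, Finset.mem_coe.1 hi]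

section IID

variable {α : Type*}

/-- The configuration `η` seen from the site `x`. -/
def shift (x : ℤ) (η : ℤ → α) (z : ℤ) : α := η (x + z)

theorem dependsOn_comp_shift {β : Type*} {F : (ℤ → α) → β} {a b : ℤ}
    (hF : DependsOn F (Set.Icc a b)) (x : ℤ) :
    DependsOn (fun η => F (shift x η)) (Set.Icc (x + a) (x + b)) := fun η η' h =>
  hF fun z hz => h (x + z) (by simpa using hz)

variable [MeasurableSpace α]

/-- The law of a configuration on `ℤ` whose heights are independent with common law `ν`. -/
noncomputable abbrev iidLaw (ν : Measure α) : Measure (ℤ → α) := Measure.infinitePi fun _ => ν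

variable (ν : Measure α) [IsProbabilityMeasure ν]

theorem measurePreserving_shift (x : ℤ) : MeasurePreserving (shift x) (iidLaw ν) (iidLaw ν) where
  measurable := measurable_pi_lambda _ fun z => measurable_pi_apply (x + z)
  map_eq := Measure.map_infinitePi_infinitePi_of_inj (P := fun _ : ℤ => ν) (add_right_injective x)

variable {F : (ℤ → α) → ℝ} {r : ℕ}

theorem indepFun_comp_shift (hF : Measurable F) (hFr : DependsOn F (Set.Icc (-r : ℤ) r)) {x y : ℤ}
    (hxy : 2 * r < |x - y|) :
    IndepFun (fun η => F (shift x η)) (fun η => F (shift y η)) (iidLaw ν) := by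
  have hmeas (x : ℤ) : Measurable fun η : ℤ → α => F (shift x η) :=
    hF.comp (measurePreserving_shift ν x).measurable
  have hdep (x : ℤ) : DependsOn (fun η : ℤ → α => F (shift x η)) (Finset.Icc (x + -r) (x + r)) :=
    Finset.coe_Icc (x + -r) (x + r : ℤ) ▸ dependsOn_comp_shift hFr x
  refine indepFun_infinitePi_of_dependsOn (hmeas x) (hmeas y) (hdep x) (hdep y) ?_
  rw [Finset.disjoint_left]
  intro z hz hz'
  simp only [Finset.mem_Icc] at hz hz'
  rcases lt_abs.1 hxy with h | h <;> lia

theorem ae_tendsto_average_shift (hF : Measurable F) (hint : Integrable F (iidLaw ν))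
    (hFr : DependsOn F (Set.Icc (-r : ℤ) r)) (c : ℤ) {d : ℤ} (hd : 2 * r < |d|) :
    ∀ᵐ η ∂(iidLaw ν), Tendsto
      (fun n : ℕ => (∑ k ∈ Finset.range n, F (shift (c + d * k) η)) / n) atTop
      (𝓝 (∫ η, F η ∂(iidLaw ν))) := by
  have hident (x : ℤ) : IdentDistrib (fun η => F (shift x η)) F (iidLaw ν) (iidLaw ν) :=
    have hshift := measurePreserving_shift ν x
    ⟨(hF.comp hshift.measurable).aemeasurable, hF.aemeasurable,
      ((hF.measurePreserving _).comp hshift).map_eq⟩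
  have hindep (i j : ℕ) (hij : i ≠ j) : IndepFun (fun η => F (shift (c + d * i) η))
      (fun η => F (shift (c + d * j) η)) (iidLaw ν) := by
    refine indepFun_comp_shift ν hF hFr ?_
    have : 1 ≤ |(i : ℤ) - j| := Int.one_le_abs (by lia)
    rw [show c + d * (i : ℤ) - (c + d * j) = d * (i - j) by ring, abs_mul]
    nlinarith [abs_nonneg d]
  have hlaw := strong_law_ae_real (μ := iidLaw ν) (fun (k : ℕ) η => F (shift (c + d * k) η))
    ((hident _).integrable_iff.2 hint) hindep fun i => (hident _).trans (hident _).symm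
  rwa [(hident _).integral_eq] at hlaw

theorem ae_hasMean_shift_of_nonneg (hF : Measurable F) (hint : Integrable F (iidLaw ν))
    (hFr : DependsOn F (Set.Icc (-r : ℤ) r)) (hF0 : ∀ η, 0 ≤ F η) :
    ∀ᵐ η ∂(iidLaw ν), HasMean (fun x => F (shift x η)) (∫ η, F η ∂(iidLaw ν)) := by
  have hlaw (d : ℤ) (hd : |d| = (2 * r + 1 : ℕ)) : ∀ᵐ η ∂(iidLaw ν), ∀ c : ℤ, Tendsto
      (fun n : ℕ => (∑ k ∈ Finset.range n, F (shift (c + d * k) η)) / n) atTop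
      (𝓝 (∫ η, F η ∂(iidLaw ν))) :=
    ae_all_iff.2 fun c => ae_tendsto_average_shift ν hF hint hFr c (by lia)
  filter_upwards [hlaw (2 * r + 1 : ℕ) (Nat.abs_cast _),
    hlaw (-(2 * r + 1 : ℕ)) (by rw [abs_neg, Nat.abs_cast])] with η hright hleft
  refine .of_tendsto_range
    (tendsto_average_of_residues (fun k => hF0 _) (m := 2 * r + 1) (by lia) fun i _ =>
      (hright i).congr fun n => ?_)
    (tendsto_average_of_residues (fun k => hF0 _) (m := 2 * r + 1) (by lia) fun i _ =>
      (hleft (-1 - i)).congr fun n => ?_)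
  · push_cast
    rfl
  · congr! 4 with k
    push_cast
    ring

theorem ae_hasMean_shift (hF : Measurable F) (hint : Integrable F (iidLaw ν))
    (hFr : DependsOn F (Set.Icc (-r : ℤ) r)) :
    ∀ᵐ η ∂(iidLaw ν), HasMean (fun x => F (shift x η)) (∫ η, F η ∂(iidLaw ν)) := by
  filter_upwards [ae_hasMean_shift_of_nonneg ν (r := r) (F := fun η => max (F η) 0)
      (hF.max measurable_const) hint.pos_part (fun η η' h => by simp only [hFr h])
      (fun η => le_max_right _ _),
    ae_hasMean_shift_of_nonneg ν (r := r) (F := fun η => max (-F η) 0)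
      (hF.neg.max measurable_const) hint.neg_part (fun η η' h => by simp only [hFr h])
      (fun η => le_max_right _ _)] with η hpos hneg
  have := hpos.sub hneg
  rw [← integral_sub hint.pos_part hint.neg_part] at this
  simpa only [max_zero_sub_max_neg_zero_eq_self] using this

theorem ae_hasMean_comp {g : α → ℝ} (hg : Measurable g) (hint : Integrable g ν) :
    ∀ᵐ η ∂(iidLaw ν), HasMean (fun x => g (η x)) (∫ a, g a ∂ν) := by
  have heval : MeasurePreserving (fun η : ℤ → α => η 0) (iidLaw ν) ν :=
    measurePreserving_eval_infinitePi (fun _ : ℤ => ν) 0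
  have hmean : ∫ η, g (η 0) ∂(iidLaw ν) = ∫ a, g a ∂ν := by
    rw [← integral_map heval.measurable.aemeasurable (by fun_prop), heval.map_eq]
  have hdep : DependsOn (fun η : ℤ → α => g (η 0)) (Set.Icc (-(0 : ℕ) : ℤ) (0 : ℕ)) :=
    fun η η' h => congrArg g (h 0 (by simp))
  have hlaw := ae_hasMean_shift ν (hg.comp heval.measurable)
    (heval.integrable_comp_of_integrable hint) hdep
  simpa only [Function.comp_def, hmean, shift, add_zero] using hlaw

end IID

/-! ### The activity density -/

theorem step_shift (x : ℤ) (η : ℤ → ℕ) : step (shift x η) = shift x (step η) := by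
  funext z
  simp only [step, shift, Active, add_sub_assoc, add_assoc]
  rfl

theorem evolve_shift (t : ℕ) (x : ℤ) (η : ℤ → ℕ) : evolve t (shift x η) = shift x (evolve t η) :=
  Function.Commute.iterate_left (step_shift x) t η

theorem activity_shift (x : ℤ) (η : ℤ → ℕ) (z : ℤ) :
    activity (shift x η) z = activity η (x + z) := rfl

theorem ae_tendsto_activeFraction_evolve (ν : Measure ℕ) [IsProbabilityMeasure ν] (t : ℕ) :
    ∀ᵐ η ∂(iidLaw ν), Tendsto (fun n : ℕ => activeFraction n (evolve t η)) atTop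
      (𝓝 (∫ η, activity (evolve t η) 0 ∂(iidLaw ν))) := by
  have hmeas := measurable_activity_evolve t 0
  have hint : Integrable (fun η => activity (evolve t η) 0) (iidLaw ν) :=
    .of_bound hmeas.aestronglyMeasurable 1 (.of_forall fun _ => norm_activity_le_one _ _)
  have hdep := dependsOn_activity_evolve t 0
  rw [zero_sub, zero_add] at hdep
  filter_upwards [ae_hasMean_shift ν hmeas hint hdep] with η hη
  simp only [evolve_shift, activity_shift, add_zero] at hη
  simpa only [activeFraction_eq_sum_activity] using hη.tendsto_average_Icc

theorem tendsto_average_integral {Ω : Type*} [MeasurableSpace Ω] {μ : Measure Ω}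
    [IsFiniteMeasure μ] {f : ℕ → Ω → ℝ} {g : Ω → ℝ} {C : ℝ}
    (hf : ∀ t, AEStronglyMeasurable (f t) μ) (hC : ∀ t ω, ‖f t ω‖ ≤ C)
    (hlim : ∀ᵐ ω ∂μ, Tendsto (fun T : ℕ => 1 / (T : ℝ) * ∑ t ∈ Finset.Icc 1 T, f t ω) atTop
      (𝓝 (g ω))) :
    Tendsto (fun T : ℕ => 1 / (T : ℝ) * ∑ t ∈ Finset.Icc 1 T, ∫ ω, f t ω ∂μ) atTop
      (𝓝 (∫ ω, g ω ∂μ)) := by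
  have hint (t : ℕ) : Integrable (f t) μ := .of_bound (hf t) C (.of_forall (hC t))
  simp only [← integral_finsetSum _ fun t _ => hint t, ← integral_const_mul]
  refine tendsto_integral_filter_of_norm_le_const (.of_forall fun T =>
    (Finset.aestronglyMeasurable_fun_sum _ fun t _ => hf t).const_mul _) ⟨C, ?_⟩ hlim
  filter_upwards [eventually_gt_atTop 0] with T hT
  refine .of_forall fun ω => ?_
  have hsum : ‖∑ t ∈ Finset.Icc 1 T, f t ω‖ ≤ T * C := by
    simpa using norm_sum_le_of_le (Finset.Icc 1 T) fun t _ => hC t ω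
  have hT' : (0 : ℝ) < T := by positivity
  rw [norm_mul, norm_div, norm_one, Real.norm_natCast, one_div_mul_eq_div, div_le_iff₀' hT']
  exact hsum

/-! ### The Poisson mean -/

theorem hasSum_poisson_mean (r : ℝ≥0) :
    HasSum (fun n : ℕ => Real.exp (-r) * r ^ n / (n.factorial : ℝ) * n) r := by
  rw [← hasSum_nat_add_iff' 1]
  simp only [Finset.range_one, Finset.sum_singleton, Nat.cast_zero, mul_zero, sub_zero]
  have hshift := (hasSum_one_poissonMeasure r).mul_left (r : ℝ)
  rw [mul_one] at hshift
  refine hshift.congr_fun fun n => ?_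
  rw [Nat.factorial_succ]
  push_cast
  field_simp
  ring

theorem integrable_cast_poissonMeasure (r : ℝ≥0) :
    Integrable (fun n : ℕ => (n : ℝ)) (poissonMeasure r) := by
  rw [integrable_poissonMeasure_iff]
  simpa using (hasSum_poisson_mean r).summable

theorem integral_cast_poissonMeasure (r : ℝ≥0) : ∫ n : ℕ, (n : ℝ) ∂(poissonMeasure r) = r := by
  rw [integral_poissonMeasure' (integrable_cast_poissonMeasure r)]
  simpa using (hasSum_poisson_mean r).tsum_eq

end Sandpile

open Sandpile in
theorem mainTheorem4_general (ν : Measure ℕ) [IsProbabilityMeasure ν]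
    (hν : Integrable (fun n : ℕ => (n : ℝ)) ν) :
    ∃ α : ℕ → ℝ,
      (∀ t : ℕ, ∀ᵐ η ∂(iidLaw ν), Tendsto
        (fun n : ℕ => activeFraction n (evolve t η)) atTop (𝓝 (α t))) ∧
      (∫ n : ℕ, (n : ℝ) ∂ν < 1 → Tendsto α atTop (𝓝 0)) ∧
      (2 < ∫ n : ℕ, (n : ℝ) ∂ν → Tendsto α atTop (𝓝 1)) ∧
      (1 < ∫ n : ℕ, (n : ℝ) ∂ν → ∫ n : ℕ, (n : ℝ) ∂ν < 2 →
        Tendsto (fun T : ℕ => 1 / (T : ℝ) * ∑ t ∈ Finset.Icc 1 T, α t) atTop (𝓝 (1 / 2))) := by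
  have hmean := ae_hasMean_comp ν (g := fun n : ℕ => (n : ℝ)) (by fun_prop) hν
  have hmeas (t : ℕ) : AEStronglyMeasurable (fun η => activity (evolve t η) 0) (iidLaw ν) :=
    (measurable_activity_evolve t 0).aestronglyMeasurable
  have hbound (t : ℕ) (η : ℤ → ℕ) : ‖activity (evolve t η) 0‖ ≤ 1 := norm_activity_le_one _ _
  have hconv {c : ℝ}
      (h : ∀ᵐ η ∂(iidLaw ν), Tendsto (fun t => activity (evolve t η) 0) atTop (𝓝 c)) :
      Tendsto (fun t => ∫ η, activity (evolve t η) 0 ∂(iidLaw ν)) atTop (𝓝 c) := by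
    simpa using tendsto_integral_filter_of_norm_le_const (.of_forall hmeas)
      ⟨1, .of_forall fun t => .of_forall (hbound t)⟩ h
  refine ⟨_, ae_tendsto_activeFraction_evolve ν, fun h1 => hconv ?_, fun h2 => hconv ?_,
    fun h1 h2 => ?_⟩
  · exact hmean.mono fun η hη => tendsto_activity_evolve_zero hη h1 0
  · exact hmean.mono fun η hη => tendsto_activity_evolve_one hη h2 0
  · simpa using tendsto_average_integral hmeas hbound
      (hmean.mono fun η hη => tendsto_average_activity_evolve hη h1 h2 0)

theorem mainTheorem4 :
    ∃ α : ℝ≥0 → ℕ → ℝ,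
      (∀ (ρ : ℝ≥0) (t : ℕ), Sandpile.IsActivityDensity ρ t (α ρ t)) ∧
      (∀ ρ : ℝ≥0, ρ < 1 → Tendsto (fun t : ℕ => α ρ t) atTop (𝓝 0)) ∧
      (∀ ρ : ℝ≥0, 2 < ρ → Tendsto (fun t : ℕ => α ρ t) atTop (𝓝 1)) ∧
      (∀ ρ : ℝ≥0, 1 < ρ → ρ < 2 →
        Tendsto (fun T : ℕ => (1 / (T : ℝ)) * ∑ t ∈ Finset.Icc 1 T, α ρ t)
          atTop (𝓝 (1 / 2))) := by
  choose α hα using fun ρ : ℝ≥0 =>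
    mainTheorem4_general (poissonMeasure ρ) (Sandpile.integrable_cast_poissonMeasure ρ)
  simp only [Sandpile.integral_cast_poissonMeasure] at hα
  exact ⟨α, fun ρ => (hα ρ).1, fun ρ h => (hα ρ).2.1 (mod_cast h),
    fun ρ h => (hα ρ).2.2.1 (mod_cast h),
    fun ρ h1 h2 => (hα ρ).2.2.2 (mod_cast h1) (mod_cast h2)⟩
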